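/- Let $\mathbb{D}=\{z\in\mathbb{C}\colon |z|<1\}$ and let $f\colon\mathbb{D}\to\mathbb{D}$ be a bijective harmonic map (that is, a complex-valued solution of $\partial\bar\partial f=0$; $f$ need not be holomorphic) that is continuously differentiable in the closed disk $\overline{\mathbb{D}}$ (that is, $f$ extends to a map on $\overline{\mathbb{D}}$ that is $C^1$ in the real sense up to the boundary). Then $$\int_{|z|=1} |\det Df|\,|dz| \geqslant 2\pi,$$ where $\det Df=|\partial f|^2-|\bar\partial f|^2$ is the Jacobian determinant of $f$. -/

import Mathlib

/-- The Wirtinger derivative `∂f = (f_x - i f_y) / 2` of `f` at `z`, the real derivative being taken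
within the set `s`. -/
noncomputable def dzWithin (f : ℂ → ℂ) (s : Set ℂ) (z : ℂ) : ℂ :=
  (1 / 2) * (fderivWithin ℝ f s z 1 - Complex.I * fderivWithin ℝ f s z Complex.I)

/-- The Wirtinger derivative `∂̄f = (f_x + i f_y) / 2` of `f` at `z`, the real derivative being taken
within the set `s`. -/
noncomputable def dzbarWithin (f : ℂ → ℂ) (s : Set ℂ) (z : ℂ) : ℂ :=
  (1 / 2) * (fderivWithin ℝ f s z 1 + Complex.I * fderivWithin ℝ f s z Complex.I)

/-- The Jacobian determinant `det Df = |∂f|² - |∂̄f|²` of `f` at `z` (derivatives within `s`). -/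
noncomputable def jacobianWithin (f : ℂ → ℂ) (s : Set ℂ) (z : ℂ) : ℝ :=
  ‖dzWithin f s z‖ ^ 2 - ‖dzbarWithin f s z‖ ^ 2

/-- `jacobianWithin` is the determinant of the real derivative. -/
theorem jacobianWithin_eq_det (f : ℂ → ℂ) (s : Set ℂ) (z : ℂ) :
    jacobianWithin f s z = (fderivWithin ℝ f s z).det := by
  have h : (fderivWithin ℝ f s z).det =
      (LinearMap.toMatrix Complex.basisOneI Complex.basisOneI
        (fderivWithin ℝ f s z : ℂ →ₗ[ℝ] ℂ)).det := by
    rw [LinearMap.det_toMatrix]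
  rw [h, Matrix.det_fin_two]
  simp only [jacobianWithin, dzWithin, dzbarWithin, LinearMap.toMatrix_apply, Complex.sq_norm,
    Complex.normSq_apply]
  simp
  ring

/-!
On the unit circle write `f (e ^ (iθ)) = e ^ (iφ(θ))`. In the frame of radial and tangential
directions the Jacobian is `φ' · N` with `N = Re (conj(f) ∂_r f)`, and the Poisson formula gives
`N(θ)` as the mean over `t` of `|f(e ^ (iθ)) - f(e ^ (it))|² / |e ^ (iθ) - e ^ (it)|²`. Since
`s ≥ 1 + log s` and the mean over `t` of `log |e ^ (iθ) - e ^ (it)|` is zero, `N(θ)` is at least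
`1 + L(f(e ^ (iθ)))`, where `L(x)` is the mean over `t` of `log |x - f(e ^ (it))|²`. The bound depends
on `θ` only through the boundary value of `f`. As these values cover the circle, integration against
`|φ'|` yields at least `∫ (1 + L) = 2π`, because the logarithmic potential `L` of a probability measure
on the circle has mean zero on the circle.

To keep all integrands continuous, the argument is run with `ρ < 1`: `|x - ρ y|` replaces `|x - y|`,
and the radial quotient `radialQuotient f ρ`, which tends to `N` boundedly as `ρ → 1`, replaces `N`.
The Poisson estimate is `one_add_circleAverage_log_le`, the change of variables is
`integral_period_le_integral_abs_deriv_mul`, and they are combined in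
`two_pi_le_integral_abs_deriv_mul_radialQuotient`.

That `f` maps the circle onto itself (`norm_eq_one_of_bijOn`, `exists_circleMap_eq_of_bijOn`) rests on
the openness of injective planar harmonic maps, `map_nhds_eq_of_harmonicOnNhd_of_injOn`. This is Lewy's
theorem: at a zero of the Jacobian some real-linear coordinate of `f` has a critical point, where at
least three arcs of a level set meet, and the other coordinate cannot be injective on their union.
-/

open Set Filter Topology InnerProductSpace

/-! ### Continuously differentiable closed curves on the unit circle -/

/-- A continuously differentiable curve on the unit circle has a continuously differentiable
phase `φ`. -/
theorem exists_phase_of_norm_eq_one {F F' : ℝ → ℂ} (hF : ∀ t, HasDerivAt F (F' t) t)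
    (hF' : Continuous F') (hnorm : ∀ t, ‖F t‖ = 1) :
    ∃ φ φ' : ℝ → ℝ, Continuous φ' ∧ (∀ t, HasDerivAt φ (φ' t) t) ∧
      (∀ t, F t = circleMap 0 1 (φ t)) ∧ ∀ t, F' t = φ' t * Complex.I * F t := by
  have hFc : Continuous F := continuous_iff_continuousAt.2 fun t => (hF t).continuousAt
  have hns : ∀ t, (F t).re * (F t).re + (F t).im * (F t).im = 1 := fun t => by
    rw [← Complex.normSq_apply, Complex.normSq_eq_norm_sq, hnorm, one_pow]
  -- differentiating `‖F‖ ^ 2 = 1` shows that `F'` is orthogonal to `F`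
  have horth : ∀ t, (F t).re * (F' t).re + (F t).im * (F' t).im = 0 := fun t => by
    have hre : HasDerivAt (fun s => (F s).re) (F' t).re t :=
      Complex.reCLM.hasFDerivAt.comp_hasDerivAt t (hF t)
    have him : HasDerivAt (fun s => (F s).im) (F' t).im t :=
      Complex.imCLM.hasFDerivAt.comp_hasDerivAt t (hF t)
    have h := (hre.mul hre).add (him.mul him)
    have hc : HasDerivAt (fun _ : ℝ => (1 : ℝ)) 0 t := hasDerivAt_const t 1
    have h2 := h.unique (hc.congr_of_eventuallyEq (Eventually.of_forall fun s => hns s))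
    linarith
  set φ' : ℝ → ℝ := fun t => (F t).re * (F' t).im - (F t).im * (F' t).re with hφ'
  have hφ'c : Continuous φ' := by fun_prop
  have hF'eq : ∀ t, F' t = φ' t * Complex.I * F t := fun t => by
    have h1 := hns t
    have h2 := horth t
    apply Complex.ext
    · simp [hφ']
      linear_combination (-(F' t).re) * h1 + (F t).re * h2
    · simp [hφ']
      linear_combination (-(F' t).im) * h1 + (F t).im * h2
  set φ : ℝ → ℝ := fun t => Complex.arg (F 0) + ∫ s in (0 : ℝ)..t, φ' s with hφ
  have hφd : ∀ t, HasDerivAt φ (φ' t) t := fun t =>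
    (intervalIntegral.integral_hasDerivAt_right (hφ'c.intervalIntegrable _ _)
      (hφ'c.stronglyMeasurableAtFilter _ _) hφ'c.continuousAt).const_add _
  have hconst : ∀ t, F t * Complex.exp (-(φ t * Complex.I)) = 1 := by
    have hd : ∀ t, HasDerivAt (fun t => F t * Complex.exp (-(φ t * Complex.I))) 0 t := fun t => by
      have h := (hF t).mul (((hφd t).ofReal_comp.mul_const Complex.I).neg.cexp)
      have h0 : F' t * Complex.exp (-(φ t * Complex.I)) +
          F t * (Complex.exp (-(φ t * Complex.I)) * -(φ' t * Complex.I)) = 0 := by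
        rw [hF'eq t]
        ring
      exact h0 ▸ h
    intro t
    have h := is_const_of_deriv_eq_zero (fun t => (hd t).differentiableAt)
      (fun t => (hd t).deriv) t 0
    rw [h]
    have hφ0 : φ 0 = Complex.arg (F 0) := by simp [hφ]
    rw [hφ0]
    nth_rewrite 1 [← Complex.norm_mul_exp_arg_mul_I (F 0)]
    rw [hnorm, Complex.ofReal_one, one_mul, ← Complex.exp_add, add_neg_cancel, Complex.exp_zero]
  refine ⟨φ, φ', hφ'c, hφd, fun t => ?_, hF'eq⟩
  have h := hconst t
  rw [Complex.exp_neg, mul_inv_eq_one₀ (Complex.exp_ne_zero _)] at h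
  rw [h, circleMap]
  simp

/-- Change of variables with multiplicity at least one: if `e ^ (i φ)` covers the unit circle,
then integrating `G ∘ φ` against `|φ'|` gives at least the integral of the nonnegative periodic
function `G` over a period. -/
theorem integral_period_le_integral_abs_deriv_mul {φ φ' G : ℝ → ℝ} (hφ' : Continuous φ')
    (hφ : ∀ t, HasDerivAt φ (φ' t) t)
    (hsurj : ∀ u : ℝ, ∃ t ∈ Icc 0 (2 * Real.pi), circleMap 0 1 (φ t) = circleMap 0 1 u)
    (hG : Continuous G) (hG0 : ∀ u, 0 ≤ G u) (hper : Function.Periodic G (2 * Real.pi)) :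
    ∫ u in (0 : ℝ)..2 * Real.pi, G u ≤ ∫ t in (0 : ℝ)..2 * Real.pi, |φ' t| * G (φ t) := by
  have hφc : Continuous φ := continuous_iff_continuousAt.2 fun t => (hφ t).continuousAt
  have hpi := Real.pi_pos
  have hne : (Icc 0 (2 * Real.pi)).Nonempty := nonempty_Icc.2 (by positivity)
  obtain ⟨a, ha, hamin⟩ := isCompact_Icc.exists_isMinOn hne hφc.continuousOn
  obtain ⟨b, hb, hbmax⟩ := isCompact_Icc.exists_isMaxOn hne hφc.continuousOn
  -- a range of length below `2π` would omit the points just above its maximum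
  have hlen : φ a + 2 * Real.pi ≤ φ b := by
    by_contra! hlt
    obtain ⟨c, hc1, hc2⟩ := exists_between hlt
    obtain ⟨t, ht, hteq⟩ := hsurj c
    have h1 : φ a ≤ φ t := hamin ht
    have h2 : φ t ≤ φ b := hbmax ht
    simp only [circleMap, zero_add, Complex.ofReal_one, one_mul] at hteq
    obtain ⟨n, hn⟩ := Complex.exp_eq_exp_iff_exists_int.1 hteq
    have hn' : φ t = c + n * (2 * Real.pi) := by
      have := congrArg Complex.im hn
      simpa using this
    rcases le_or_gt 0 n with h | h
    · have : (0 : ℝ) ≤ n := by exact_mod_cast h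
      nlinarith
    · have : (n : ℝ) ≤ -1 := by exact_mod_cast (by lia : n ≤ -1)
      nlinarith
  have hcont : Continuous fun t => |φ' t| * G (φ t) := by fun_prop
  have hnn : ∀ t, 0 ≤ |φ' t| * G (φ t) := fun t => mul_nonneg (abs_nonneg _) (hG0 _)
  have hsubst : ∫ t in a..b, G (φ t) * φ' t = ∫ u in φ a..φ b, G u :=
    intervalIntegral.integral_comp_mul_deriv (fun t _ => hφ t) hφ'.continuousOn hG
  have hge : ∫ u in (0 : ℝ)..2 * Real.pi, G u ≤ ∫ u in φ a..φ b, G u := by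
    have h := hper.intervalIntegral_add_eq 0 (φ a)
    rw [zero_add] at h
    rw [h]
    exact intervalIntegral.integral_mono_interval le_rfl (by linarith) hlen
      (Eventually.of_forall hG0) (hG.intervalIntegrable _ _)
  calc ∫ u in (0 : ℝ)..2 * Real.pi, G u ≤ ∫ t in a..b, G (φ t) * φ' t := hsubst ▸ hge
    _ ≤ |∫ t in a..b, G (φ t) * φ' t| := le_abs_self _
    _ ≤ |∫ t in a..b, ‖G (φ t) * φ' t‖| := by
        simpa only [Real.norm_eq_abs] using
          intervalIntegral.norm_integral_le_abs_integral_norm (f := fun t => G (φ t) * φ' t)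
    _ = |∫ t in a..b, |φ' t| * G (φ t)| := by
        congr 2 with t
        rw [Real.norm_eq_abs, abs_mul, abs_of_nonneg (hG0 _), mul_comm]
    _ ≤ |∫ t in (0 : ℝ)..2 * Real.pi, |φ' t| * G (φ t)| := by
        refine intervalIntegral.abs_integral_mono_interval ?_ (Eventually.of_forall hnn)
          (hcont.intervalIntegrable _ _)
        rw [uIoc_of_le (by positivity : (0 : ℝ) ≤ 2 * Real.pi)]
        exact Ioc_subset_Ioc (le_min ha.1 hb.1) (max_le ha.2 hb.2)
    _ = _ := abs_of_nonneg (intervalIntegral.integral_nonneg (by positivity) fun t _ => hnn t)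

/-! ### Logarithmic lower bound from the Poisson formula -/

theorem circleAverage_log_norm_sub_mul_eq_zero {ρ : ℝ} (h0 : 0 ≤ ρ) (h1 : ρ < 1) {w : ℂ}
    (hw : ‖w‖ = 1) :
    Real.circleAverage (fun x => 2 * Real.log ‖x - ρ * w‖) 0 1 = 0 := by
  have h : Real.circleAverage (fun x => Real.log ‖x - ρ * w‖) 0 1 = 0 :=
    circleAverage_log_norm_sub_const₀ (by simpa [hw, abs_of_nonneg h0] using h1)
  have h2 := Real.circleAverage_fun_smul (a := (2 : ℝ)) (f := fun x : ℂ => Real.log ‖x - ρ * w‖)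
    (c := 0) (R := 1)
  simpa [h] using h2

theorem norm_sub_mul_pos {ρ : ℝ} (h0 : 0 ≤ ρ) (h1 : ρ < 1) {x y : ℂ} (hx : ‖x‖ = 1)
    (hy : ‖y‖ = 1) : 0 < ‖x - ρ * y‖ := by
  have h := norm_sub_norm_le x (ρ * y)
  rw [norm_mul, hx, hy, Complex.norm_real, Real.norm_of_nonneg h0] at h
  linarith

theorem sq_norm_sub_mul {ρ : ℝ} {x y : ℂ} (hx : ‖x‖ = 1) (hy : ‖y‖ = 1) :
    ‖x - ρ * y‖ ^ 2 = 1 + ρ ^ 2 - 2 * ρ * (y * starRingEnd ℂ x).re := by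
  have hx' : x.re * x.re + x.im * x.im = 1 := by
    rw [← Complex.normSq_apply, Complex.normSq_eq_norm_sq, hx, one_pow]
  have hy' : y.re * y.re + y.im * y.im = 1 := by
    rw [← Complex.normSq_apply, Complex.normSq_eq_norm_sq, hy, one_pow]
  rw [Complex.sq_norm, Complex.normSq_apply]
  simp
  linear_combination hx' + ρ ^ 2 * hy'

/-- For a harmonic `f` mapping the unit circle into itself, the difference quotient
`(1 + ρ² - 2ρ Re (f(ρz) x̄)) / (1 - ρ²)` is the mean over `y` of
`‖x - ρ f y‖² / ‖y - ρ z‖²`; the inequality `s ≥ 1 + log s` bounds it from below. The term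
`log ‖y - ρ z‖` has mean zero, so the bound does not depend on `z`. -/
theorem one_add_circleAverage_log_le {f : ℂ → ℂ} (hf : HarmonicContOnCl f (Metric.ball 0 1))
    (hcirc : ∀ z, ‖z‖ = 1 → ‖f z‖ = 1) {ρ : ℝ} (h0 : 0 ≤ ρ) (h1 : ρ < 1) {x z : ℂ}
    (hx : ‖x‖ = 1) (hz : ‖z‖ = 1) :
    1 + Real.circleAverage (fun y => 2 * Real.log ‖x - ρ * f y‖) 0 1 ≤
      (1 + ρ ^ 2 - 2 * ρ * (f (ρ * z) * starRingEnd ℂ x).re) / (1 - ρ ^ 2) := by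
  have hρ : 0 < 1 - ρ ^ 2 := by nlinarith
  set h : ℂ → ℝ := fun y =>
    (1 + ρ ^ 2) / (1 - ρ ^ 2) - (2 * ρ) / (1 - ρ ^ 2) * (f y * starRingEnd ℂ x).re with hdef
  set l : ℂ →L[ℝ] ℝ := Complex.reCLM.comp ((ContinuousLinearMap.mul ℝ ℂ).flip (starRingEnd ℂ x))
  have hharm : HarmonicContOnCl h (Metric.ball 0 1) :=
    ((hf.comp_CLM l).const_smul ((2 * ρ) / (1 - ρ ^ 2))).const_sub ((1 + ρ ^ 2) / (1 - ρ ^ 2))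
  have hw : (ρ * z : ℂ) ∈ Metric.ball (0 : ℂ) 1 := by
    simpa [hz, abs_of_nonneg h0] using h1
  have hpois := hharm.circleAverage_poissonKernel_smul hw
  have hsph : ∀ y ∈ Metric.sphere (0 : ℂ) |1|, ‖y‖ = 1 := fun y hy => by simpa using hy
  have hfc : ContinuousOn f (Metric.sphere (0 : ℂ) 1) :=
    hf.continuousOn_ball.mono Metric.sphere_subset_closedBall
  have hhc : ContinuousOn h (Metric.sphere (0 : ℂ) 1) :=
    hharm.continuousOn_ball.mono Metric.sphere_subset_closedBall
  have hi1 : CircleIntegrable (fun y => 2 * Real.log ‖x - ρ * f y‖) 0 1 := by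
    refine ContinuousOn.circleIntegrable zero_le_one ?_
    refine continuousOn_const.mul (ContinuousOn.log (by fun_prop) fun y hy => ?_)
    exact (norm_sub_mul_pos h0 h1 hx (hcirc y (by simpa using hy))).ne'
  have hi2 : CircleIntegrable (fun y => 2 * Real.log ‖y - ρ * z‖) 0 1 := by
    refine ContinuousOn.circleIntegrable zero_le_one ?_
    refine continuousOn_const.mul (ContinuousOn.log (by fun_prop) fun y hy => ?_)
    exact (norm_sub_mul_pos h0 h1 (by simpa using hy) hz).ne'
  have hi3 : CircleIntegrable (poissonKernel 0 (ρ * z) • h) 0 1 := by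
    refine ContinuousOn.circleIntegrable zero_le_one ?_
    refine ContinuousOn.smul ?_ hhc
    unfold poissonKernel
    refine ContinuousOn.div (by fun_prop) (by fun_prop) fun y hy => ?_
    have := norm_sub_mul_pos h0 h1 (by simpa using hy : ‖y‖ = 1) hz
    simp only [sub_zero]
    positivity
  have hci : CircleIntegrable (fun _ : ℂ => (1 : ℝ)) 0 1 := circleIntegrable_const _ _ _
  have hi4 : CircleIntegrable (fun y => 1 + 2 * Real.log ‖x - ρ * f y‖) 0 1 := hci.add hi1
  have hmono := Real.circleAverage_mono (f₁ := fun y =>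
      1 + 2 * Real.log ‖x - ρ * f y‖ - 2 * Real.log ‖y - ρ * z‖) (hi4.sub hi2) hi3
    fun y hy => by
      have hy1 := hsph y hy
      have hA := norm_sub_mul_pos h0 h1 hx (hcirc y hy1)
      have hB := norm_sub_mul_pos h0 h1 hy1 hz
      have hle := Real.add_one_le_exp
        (Real.log (‖x - ρ * f y‖ ^ 2 / ‖y - ρ * z‖ ^ 2))
      rw [Real.exp_log (by positivity), Real.log_div (by positivity) (by positivity),
        Real.log_pow, Real.log_pow] at hle
      have heq : (poissonKernel 0 (ρ * z) • h) y = ‖x - ρ * f y‖ ^ 2 / ‖y - ρ * z‖ ^ 2 := by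
        rw [sq_norm_sub_mul hx (hcirc y hy1)]
        simp only [poissonKernel, hdef, Pi.smul_apply', smul_eq_mul, sub_zero, hy1, norm_mul, hz,
          Complex.norm_real, Real.norm_of_nonneg h0]
        field_simp
      rw [heq]
      push_cast at hle
      linarith
  rw [hpois, Real.circleAverage_fun_sub hi4 hi2, Real.circleAverage_fun_add hci hi1,
    circleAverage_log_norm_sub_mul_eq_zero h0 h1 hz, Real.circleAverage_const] at hmono
  simp only [hdef] at hmono
  calc _ ≤ _ := by simpa only [sub_zero] using hmono
    _ = _ := by ring

/-- Exchanging the integrals, the integral over the unit circle of the logarithmic potential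
`x ↦ ∫ log ‖x - ρ F t‖² dt` vanishes, since the integral over `x` does for each `t`. -/
theorem integral_integral_log_norm_sub_mul_eq_zero {F : ℝ → ℂ} (hF : Continuous F)
    (hnorm : ∀ t, ‖F t‖ = 1) {ρ : ℝ} (h0 : 0 ≤ ρ) (h1 : ρ < 1) :
    ∫ u in (0 : ℝ)..2 * Real.pi, ∫ t in (0 : ℝ)..2 * Real.pi,
      2 * Real.log ‖circleMap 0 1 u - ρ * F t‖ = 0 := by
  have hc : Continuous fun p : ℝ × ℝ => 2 * Real.log ‖circleMap 0 1 p.1 - ρ * F p.2‖ := by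
    refine continuous_const.mul (Continuous.log (by fun_prop) fun p => ?_)
    exact (norm_sub_mul_pos h0 h1 (by simp) (hnorm _)).ne'
  rw [MeasureTheory.intervalIntegral_intervalIntegral_swap]
  · refine (intervalIntegral.integral_congr (g := fun _ => 0) fun t _ => ?_).trans (by simp)
    have h := circleAverage_log_norm_sub_mul_eq_zero h0 h1 (hnorm t)
    rw [Real.circleAverage_def, smul_eq_zero] at h
    exact h.resolve_left (by positivity)
  · exact (hc.continuousOn.integrableOn_compact
      (isCompact_uIcc.prod isCompact_uIcc)).mono_set
        (prod_mono uIoc_subset_uIcc uIoc_subset_uIcc)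

/-! ### Injective harmonic maps of the plane are open -/

/-- Local normal form at a critical point: in a suitable continuous coordinate `k`, an analytic
function is a constant plus a multiple of a power `w ^ n` with `n ≥ 2`. The multiple is `0` when
the function is locally constant. -/
theorem AnalyticAt.exists_coordinate_of_deriv_eq_zero {Φ : ℂ → ℂ} {z₀ : ℂ}
    (hΦ : AnalyticAt ℂ Φ z₀) (hd : deriv Φ z₀ = 0) :
    ∃ n : ℕ, 2 ≤ n ∧ ∃ (c : ℝ) (k : ℂ → ℂ), ∃ S ∈ 𝓝 (0 : ℂ), ContinuousOn k S ∧ InjOn k S ∧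
      k 0 = z₀ ∧ ∀ w ∈ S, Φ (k w) = Φ z₀ + c * w ^ n := by
  by_cases hconst : ∀ᶠ z in 𝓝 z₀, Φ z - Φ z₀ = 0
  · have ht : Tendsto (fun w : ℂ => z₀ + w) (𝓝 0) (𝓝 z₀) := by
      have : Continuous fun w : ℂ => z₀ + w := by fun_prop
      simpa using this.tendsto 0
    refine ⟨2, le_rfl, 0, fun w => z₀ + w, _, ht.eventually hconst, by fun_prop,
      (add_right_injective z₀).injOn, add_zero z₀, fun w hw => ?_⟩
    have hw' : Φ (z₀ + w) - Φ z₀ = 0 := hw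
    rw [sub_eq_zero.1 hw']
    simp
  obtain ⟨n, g, hg, hg0, hgΦ⟩ :=
    (hΦ.sub analyticAt_const).exists_eventuallyEq_pow_smul_nonzero_iff.2 hconst
  have hgΦ' : ∀ᶠ z in 𝓝 z₀, Φ z = Φ z₀ + (z - z₀) ^ n * g z := by
    filter_upwards [hgΦ] with z hz
    rw [← smul_eq_mul, ← hz]
    simp
  have hn0 : n ≠ 0 := by
    rintro rfl
    have := hgΦ'.self_of_nhds
    simp [hg0] at this
  have hn1 : n ≠ 1 := by
    rintro rfl
    have h1 : HasDerivAt (fun z => Φ z₀ + (z - z₀) ^ 1 * g z) (g z₀) z₀ := by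
      have h := ((hasDerivAt_id z₀).sub_const z₀).mul hg.differentiableAt.hasDerivAt
      simpa using h.const_add (Φ z₀)
    have h2 := (h1.congr_of_eventuallyEq hgΦ').deriv
    exact hg0 (h2.symm.trans hd)
  have hnC : (n : ℂ) ≠ 0 := Nat.cast_ne_zero.2 hn0
  -- an analytic `n`-th root of `g` near `z₀`
  obtain ⟨b, hb⟩ := IsAlgClosed.exists_pow_nat_eq (g z₀) (Nat.pos_of_ne_zero hn0)
  have hb0 : b ≠ 0 := by
    rintro rfl
    exact hg0 (by rw [← hb, zero_pow hn0])
  set q : ℂ → ℂ := fun z => b * Complex.exp (Complex.log (g z / g z₀) / n) with hq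
  have hqan : AnalyticAt ℂ q z₀ := by
    refine analyticAt_const.mul (AnalyticAt.cexp (AnalyticAt.div ?_ analyticAt_const hnC))
    refine AnalyticAt.clog (hg.div analyticAt_const hg0) ?_
    simp only [div_self hg0]
    exact Complex.one_mem_slitPlane
  have hqz : q z₀ = b := by simp [hq, div_self hg0]
  have hqpow : ∀ z, g z ≠ 0 → q z ^ n = g z := fun z hz => by
    rw [hq, mul_pow, hb, ← Complex.exp_nat_mul, mul_div_cancel₀ _ hnC,
      Complex.exp_log (div_ne_zero hz hg0), mul_div_cancel₀ _ hg0]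
  have hH : HasStrictDerivAt (fun z => (z - z₀) * q z) b z₀ := by
    have h : HasStrictDerivAt (fun z => (z - z₀) * q z) (1 * q z₀ + (z₀ - z₀) * deriv q z₀) z₀ :=
      HasStrictDerivAt.mul ((hasStrictDerivAt_id z₀).sub_const z₀) hqan.hasStrictDerivAt
    rwa [sub_self, zero_mul, add_zero, one_mul, hqz] at h
  set e := (hH.hasStrictFDerivAt_equiv hb0).toOpenPartialHomeomorph (fun z => (z - z₀) * q z)
    with he
  have hecoe : ∀ z, e z = (z - z₀) * q z := fun z => by
    rw [he, HasStrictFDerivAt.toOpenPartialHomeomorph_coe]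
  have hsrc : z₀ ∈ e.source := HasStrictFDerivAt.mem_toOpenPartialHomeomorph_source _
  have hez : e z₀ = 0 := by simp [hecoe]
  have htgt : (0 : ℂ) ∈ e.target := hez ▸ e.map_source hsrc
  have hk0 : e.symm 0 = z₀ := by rw [← hez, e.left_inv hsrc]
  have hkt : Tendsto e.symm (𝓝 0) (𝓝 z₀) := by
    have h := e.symm.continuousAt htgt
    rwa [ContinuousAt, hk0] at h
  have hev : ∀ᶠ w in 𝓝 (0 : ℂ), Φ (e.symm w) = Φ z₀ + (1 : ℝ) * w ^ n := by
    filter_upwards [hkt.eventually hgΦ', hkt.eventually (hg.continuousAt.eventually_ne hg0),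
      e.open_target.mem_nhds htgt] with w h1 h2 h3
    have h4 := hecoe (e.symm w)
    rw [e.right_inv h3] at h4
    rw [h1, Complex.ofReal_one, one_mul]
    nth_rewrite 3 [h4]
    rw [mul_pow, hqpow _ h2]
  refine ⟨n, by lia, 1, e.symm, _, inter_mem (e.open_target.mem_nhds htgt) hev,
    e.symm.continuousOn.mono inter_subset_left, e.symm.injOn.mono inter_subset_left, hk0,
    fun w hw => hw.2⟩

/-- Three distinct directions along which `w ^ n` is purely imaginary. -/
theorem exists_three_directions {n : ℕ} (hn : 2 ≤ n) :
    ∃ ω : Fin 3 → ℂ, Function.Injective ω ∧ ∀ i, ‖ω i‖ = 1 ∧ (ω i ^ n).re = 0 := by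
  have hn0 : (n : ℂ) ≠ 0 := Nat.cast_ne_zero.2 (by lia)
  set α : ℂ := Complex.exp (Real.pi * Complex.I / (2 * n)) with hα
  set ζ : ℂ := Complex.exp (2 * Real.pi * Complex.I / n) with hζ
  set β : ℂ := Complex.exp (3 * Real.pi * Complex.I / (2 * n)) with hβ
  have hζ1 : ζ ≠ 1 := (Complex.isPrimitiveRoot_exp n (by lia)).ne_one (by lia)
  have hα0 : α ≠ 0 := Complex.exp_ne_zero _
  have hβα : β ^ 2 = ζ * α ^ 2 := by
    rw [hβ, hζ, hα, ← Complex.exp_nat_mul, ← Complex.exp_nat_mul, ← Complex.exp_add]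
    congr 1
    field_simp
    push_cast
    ring
  have hne : β ^ 2 ≠ α ^ 2 := fun h =>
    hζ1 (mul_right_cancel₀ (pow_ne_zero 2 hα0) (by rw [← hβα, h, one_mul]))
  have hαn : α ^ n = Complex.I := by
    rw [hα, ← Complex.exp_nat_mul]
    have : (n : ℂ) * (Real.pi * Complex.I / (2 * n)) = Real.pi / 2 * Complex.I := by
      field_simp
    rw [this, Complex.exp_pi_div_two_mul_I]
  have hβn : β ^ n = -Complex.I := by
    rw [hβ, ← Complex.exp_nat_mul]
    have : (n : ℂ) * (3 * Real.pi * Complex.I / (2 * n)) =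
        Real.pi * Complex.I + Real.pi / 2 * Complex.I := by
      field_simp
      ring
    rw [this, Complex.exp_add, Complex.exp_pi_mul_I, Complex.exp_pi_div_two_mul_I]
    ring
  have hαnorm : ‖α‖ = 1 :=
    (pow_eq_one_iff_of_nonneg (n := n) (norm_nonneg _) (by lia)).1
      (by rw [← norm_pow, hαn, Complex.norm_I])
  have hβnorm : ‖β‖ = 1 :=
    (pow_eq_one_iff_of_nonneg (n := n) (norm_nonneg _) (by lia)).1
      (by rw [← norm_pow, hβn, norm_neg, Complex.norm_I])
  have h01 : α ≠ -α := fun h => hα0 (self_eq_neg.1 h)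
  have h02 : α ≠ β := fun h => hne (by rw [h])
  have h12 : -α ≠ β := fun h => hne (by rw [← h, neg_sq])
  refine ⟨![α, -α, β], ?_, ?_⟩
  · intro i j hij
    fin_cases i <;> fin_cases j <;> simp_all
  · intro i
    fin_cases i
    · simp [hαnorm, hαn]
    · refine ⟨by simp [hαnorm], ?_⟩
      change ((-α) ^ n).re = 0
      rw [neg_pow, hαn]
      rcases neg_one_pow_eq_or ℂ n with h | h <;> simp [h]
    · simp [hβnorm, hβn]

theorem exists_eq_ne_zero_of_mul_pos {v w : ℝ → ℝ} {δ : ℝ} (hδ : 0 ≤ δ)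
    (hv : ContinuousOn v (Icc 0 δ)) (hw : ContinuousOn w (Icc 0 δ)) (hv0 : v 0 = 0)
    (hw0 : w 0 = 0) (hpos : 0 < v δ * w δ) :
    ∃ s ∈ Icc 0 δ, ∃ t ∈ Icc 0 δ, v s = w t ∧ v s ≠ 0 := by
  rcases mul_pos_iff.1 hpos with ⟨h1, h2⟩ | ⟨h1, h2⟩
  · have h3 : 0 < min (v δ) (w δ) := lt_min h1 h2
    obtain ⟨s, hs, hs'⟩ := intermediate_value_Icc hδ hv ⟨hv0.trans_le h3.le, min_le_left _ _⟩
    obtain ⟨t, ht, ht'⟩ := intermediate_value_Icc hδ hw ⟨hw0.trans_le h3.le, min_le_right _ _⟩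
    exact ⟨s, hs, t, ht, hs'.trans ht'.symm, hs' ▸ h3.ne'⟩
  · have h3 : max (v δ) (w δ) < 0 := max_lt h1 h2
    obtain ⟨s, hs, hs'⟩ := intermediate_value_Icc' hδ hv ⟨le_max_left _ _, h3.le.trans_eq hv0.symm⟩
    obtain ⟨t, ht, ht'⟩ := intermediate_value_Icc' hδ hw ⟨le_max_right _ _, h3.le.trans_eq hw0.symm⟩
    exact ⟨s, hs, t, ht, hs'.trans ht'.symm, hs' ▸ h3.ne⟩

/-- The core of Lewy's theorem. If the analytic function `Φ` has a critical point, at least three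
arcs of the level set of `Re Φ = Re f` issue from it. Along each of them `Im f` takes all small
values of one sign, so two of the arcs share a value of `f`. -/
theorem deriv_ne_zero_of_injOn_of_re_eq {f Φ : ℂ → ℂ} {U : Set ℂ} {z₀ : ℂ} (hU : U ∈ 𝓝 z₀)
    (hinj : InjOn f U) (hf : ContinuousOn f U) (hΦ : AnalyticAt ℂ Φ z₀)
    (hre : ∀ z ∈ U, (Φ z).re = (f z).re) : deriv Φ z₀ ≠ 0 := by
  intro hd
  obtain ⟨n, hn, c, k, S, hS, hkc, hkinj, hk0, hk⟩ := hΦ.exists_coordinate_of_deriv_eq_zero hd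
  have hpre : k ⁻¹' U ∈ 𝓝 (0 : ℂ) :=
    (hkc.continuousAt hS).preimage_mem_nhds (hk0.symm ▸ hU)
  obtain ⟨r, hr, hrS⟩ := Metric.mem_nhds_iff.1 (inter_mem hS hpre)
  obtain ⟨δ, hδ0, hδr⟩ := exists_between hr
  obtain ⟨ω, hωinj, hω⟩ := exists_three_directions hn
  have hmem : ∀ i, ∀ s ∈ Icc 0 δ, (s * ω i : ℂ) ∈ S ∩ k ⁻¹' U := fun i s hs => hrS (by
    rw [mem_ball_zero_iff, norm_mul, (hω i).1, mul_one, Complex.norm_real, Real.norm_eq_abs,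
      abs_of_nonneg hs.1]
    exact hs.2.trans_lt hδr)
  have hz₀ : z₀ ∈ U := mem_of_mem_nhds hU
  have hlevel : ∀ i, ∀ s ∈ Icc 0 δ, (f (k (s * ω i))).re = (f z₀).re := fun i s hs => by
    have hm := hmem i s hs
    rw [← hre _ hm.2, ← hre _ hz₀, hk _ hm.1, mul_pow, ← Complex.ofReal_pow, ← mul_assoc,
      ← Complex.ofReal_mul, Complex.add_re, Complex.re_ofReal_mul, (hω i).2, mul_zero, add_zero]
  set v : Fin 3 → ℝ → ℝ := fun i s => (f (k (s * ω i))).im - (f z₀).im with hv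
  have hvc : ∀ i, ContinuousOn (v i) (Icc 0 δ) := fun i => by
    refine ContinuousOn.sub (Complex.continuous_im.comp_continuousOn ?_) continuousOn_const
    have hfk : ContinuousOn (fun w => f (k w)) (S ∩ k ⁻¹' U) :=
      hf.comp (hkc.mono inter_subset_left) fun w hw => hw.2
    have hline : Continuous fun s : ℝ => (s * ω i : ℂ) := Complex.continuous_ofReal.mul_const _
    exact hfk.comp hline.continuousOn (hmem i)
  have hv0 : ∀ i, v i 0 = 0 := fun i => by simp [hv, hk0]
  have hωδ : ∀ i, (δ * ω i : ℂ) ≠ 0 := fun i => by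
    have h1 : ω i ≠ 0 := norm_ne_zero_iff.1 (by rw [(hω i).1]; exact one_ne_zero)
    exact mul_ne_zero (Complex.ofReal_ne_zero.2 hδ0.ne') h1
  have hvδ : ∀ i, v i δ ≠ 0 := fun i h => by
    have hδm : δ ∈ Icc 0 δ := ⟨hδ0.le, le_rfl⟩
    have h1 : f (k (δ * ω i)) = f (k 0) := by
      rw [hk0]
      exact Complex.ext (hlevel i δ hδm) (sub_eq_zero.1 h)
    have h2 : k (δ * ω i) = k 0 := hinj (hmem i δ hδm).2 (by rw [hk0]; exact hz₀) h1
    exact hωδ i (hkinj (hmem i δ hδm).1 (mem_of_mem_nhds hS) h2)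
  have hopp : ∀ i j, i ≠ j → v i δ * v j δ < 0 := fun i j hij => by
    by_contra! hnn
    have hpos := lt_of_le_of_ne hnn (mul_ne_zero (hvδ i) (hvδ j)).symm
    obtain ⟨s, hs, t, ht, hst, hs0⟩ :=
      exists_eq_ne_zero_of_mul_pos hδ0.le (hvc i) (hvc j) (hv0 i) (hv0 j) hpos
    have h1 : f (k (s * ω i)) = f (k (t * ω j)) :=
      Complex.ext ((hlevel i s hs).trans (hlevel j t ht).symm) (sub_left_inj.1 hst)
    have h2 : (s * ω i : ℂ) = t * ω j :=
      hkinj (hmem i s hs).1 (hmem j t ht).1 (hinj (hmem i s hs).2 (hmem j t ht).2 h1)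
    have h3 : s = t := by
      have h := congrArg norm h2
      simpa [(hω i).1, (hω j).1, abs_of_nonneg hs.1, abs_of_nonneg ht.1] using h
    have hs1 : (s : ℂ) ≠ 0 := Complex.ofReal_ne_zero.2 fun h => hs0 (h ▸ hv0 i)
    rw [← h3] at h2
    exact hij (hωinj (mul_left_cancel₀ hs1 h2))
  have h01 := hopp 0 1 (by decide)
  have h02 := hopp 0 2 (by decide)
  have h12 := hopp 1 2 (by decide)
  have h := mul_pos_of_neg_of_neg h01 h02
  nlinarith [mul_neg_of_pos_of_neg h h12, sq_nonneg (v 0 δ * v 1 δ * v 2 δ)]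

/-- Lewy's theorem, in the form of openness: an injective planar harmonic map is open. -/
theorem map_nhds_eq_of_harmonicOnNhd_of_injOn {f : ℂ → ℂ} {c : ℂ} {R : ℝ}
    (hf : HarmonicOnNhd f (Metric.ball c R)) (hinj : InjOn f (Metric.ball c R)) {z₀ : ℂ}
    (hz₀ : z₀ ∈ Metric.ball c R) : map f (𝓝 z₀) = 𝓝 (f z₀) := by
  have hU : Metric.ball c R ∈ 𝓝 z₀ := Metric.isOpen_ball.mem_nhds hz₀
  have hstrict : HasStrictFDerivAt f (fderiv ℝ f z₀) z₀ :=
    (hf z₀ hz₀).1.hasStrictFDerivAt two_ne_zero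
  refine hstrict.map_nhds_eq_of_surj ?_
  by_contra hrange
  -- a nonzero real functional `w ↦ Re (a w)` annihilates the range of the derivative
  obtain ⟨l, hl0, hl⟩ := Submodule.exists_le_ker_of_lt_top _ (lt_top_iff_ne_top.2 hrange)
  set a : ℂ := ⟨l 1, -l Complex.I⟩ with ha
  have hla : ∀ w, l w = (a * w).re := fun w => by
    have hw : w = w.re • (1 : ℂ) + w.im • Complex.I := by
      simp [Complex.re_add_im]
    conv_lhs => rw [hw, map_add, map_smul, map_smul]
    simp [ha]
    ring
  have ha0 : a ≠ 0 := by
    rintro h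
    exact hl0 (LinearMap.ext fun w => by rw [hla, h]; simp)
  set L : ℂ →L[ℝ] ℝ := Complex.reCLM.comp (ContinuousLinearMap.mul ℝ ℂ a) with hL
  obtain ⟨Φ, hΦ, hΦre⟩ := (hf.comp_CLM L).exists_analyticOnNhd_ball_re_eq
  have hΦd := (hΦ z₀ hz₀).differentiableAt.hasDerivAt
  refine deriv_ne_zero_of_injOn_of_re_eq (f := fun z => a * f z) hU
    (fun x hx y hy hxy => hinj hx hy (mul_left_cancel₀ ha0 hxy))
    (continuousOn_const.mul hf.continuousOn) (hΦ z₀ hz₀) (fun z hz => hΦre hz) ?_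
  have h1 : HasFDerivAt (fun z => (Φ z).re) _ z₀ :=
    Complex.reCLM.hasFDerivAt.comp z₀ hΦd.complexToReal_fderiv
  have h2 : HasFDerivAt (fun z => (Φ z).re) (L.comp (fderiv ℝ f z₀)) z₀ :=
    (L.hasFDerivAt.comp z₀ hstrict.hasFDerivAt).congr_of_eventuallyEq
      (eventually_of_mem hU fun z hz => hΦre hz)
  have h3 : ∀ w, (deriv Φ z₀ * w).re = 0 := fun w => by
    have h4 := DFunLike.congr_fun (h1.unique h2) w
    have h5 : (a * fderiv ℝ f z₀ w).re = 0 := by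
      rw [← hla]
      exact hl ⟨w, rfl⟩
    simpa [hL, h5] using h4
  have h6 := h3 1
  have h7 := h3 Complex.I
  apply Complex.ext
  · simpa using h6
  · simpa using h7

/-! ### Boundary values and the limit of the difference quotients -/

/-- A harmonic bijection of the disk that is continuous up to the boundary is proper, so that it
maps the unit circle into itself. -/
theorem norm_eq_one_of_bijOn {f : ℂ → ℂ} (hbij : BijOn f (Metric.ball 0 1) (Metric.ball 0 1))
    (hf : HarmonicContOnCl f (Metric.ball 0 1)) {z : ℂ} (hz : ‖z‖ = 1) : ‖f z‖ = 1 := by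
  have hcl : z ∈ closure (Metric.ball (0 : ℂ) 1) := by
    rw [closure_ball _ one_ne_zero]
    simp [hz]
  have hcont : Tendsto f (𝓝[Metric.ball 0 1] z) (𝓝 (f z)) :=
    ((hf.continuousOn z hcl).mono subset_closure).tendsto
  have : (𝓝[Metric.ball (0 : ℂ) 1] z).NeBot := mem_closure_iff_nhdsWithin_neBot.1 hcl
  have hle : ‖f z‖ ≤ 1 := by
    refine le_of_tendsto hcont.norm (eventually_mem_nhdsWithin.mono fun w hw => ?_)
    exact (mem_ball_zero_iff.1 (hbij.mapsTo hw)).le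
  refine hle.eq_of_not_lt fun hlt => ?_
  -- otherwise `f z = f w` for some `w` inside, and points near `z` and near `w` share their values
  obtain ⟨w, hw, hwz⟩ := hbij.surjOn (mem_ball_zero_iff.2 hlt)
  have hne : w ≠ z := by
    rintro rfl
    rw [mem_ball_zero_iff, hz] at hw
    exact lt_irrefl _ hw
  obtain ⟨V, W, hV, hW, hwV, hzW, hdisj⟩ := t2_separation hne
  have himg : f '' (V ∩ Metric.ball 0 1) ∈ 𝓝 (f z) := by
    rw [← hwz, ← map_nhds_eq_of_harmonicOnNhd_of_injOn hf.1 hbij.injOn hw]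
    exact image_mem_map (inter_mem (hV.mem_nhds hwV) (Metric.isOpen_ball.mem_nhds hw))
  have hev : ∀ᶠ x in 𝓝[Metric.ball 0 1] z,
      x ∈ Metric.ball (0 : ℂ) 1 ∧ x ∈ W ∧ f x ∈ f '' (V ∩ Metric.ball 0 1) :=
    eventually_mem_nhdsWithin.and
      ((eventually_nhdsWithin_of_eventually_nhds (hW.eventually_mem hzW)).and (hcont.eventually himg))
  obtain ⟨x, hxb, hxW, y, ⟨hyV, hyb⟩, hyx⟩ := hev.exists
  have hxy : y = x := hbij.injOn hyb hxb hyx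
  exact disjoint_left.1 hdisj hyV (hxy ▸ hxW)

theorem exists_circleMap_eq_of_bijOn {f : ℂ → ℂ}
    (hbij : BijOn f (Metric.ball 0 1) (Metric.ball 0 1))
    (hf : ContinuousOn f (Metric.closedBall 0 1)) {w : ℂ} (hw : ‖w‖ = 1) :
    ∃ t ∈ Icc 0 (2 * Real.pi), f (circleMap 0 1 t) = w := by
  have hcl : Metric.closedBall (0 : ℂ) 1 ⊆ f '' Metric.closedBall 0 1 := by
    nth_rewrite 1 [← closure_ball _ one_ne_zero]
    exact closure_minimal
      (hbij.image_eq.symm.subset.trans (image_mono Metric.ball_subset_closedBall))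
      ((isCompact_closedBall _ _).image_of_continuousOn hf).isClosed
  obtain ⟨z, hz, hzw⟩ := hcl (by simp [hw] : w ∈ Metric.closedBall (0 : ℂ) 1)
  have hz1 : ‖z‖ = 1 := by
    refine (mem_closedBall_zero_iff.1 hz).eq_of_not_lt fun hlt => ?_
    have := mem_ball_zero_iff.1 (hbij.mapsTo (mem_ball_zero_iff.2 hlt))
    rw [hzw, hw] at this
    exact lt_irrefl _ this
  have hz2 : z ∈ circleMap 0 1 '' Ioc 0 (2 * Real.pi) := by
    rw [image_circleMap_Ioc]
    simp [hz1]
  obtain ⟨t, ht, rfl⟩ := hz2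
  exact ⟨t, Ioc_subset_Icc_self ht, hzw⟩

/-- The determinant of a real-linear map in the orthonormal frame `z`, `i z`. -/
theorem jacobianWithin_eq_im {f : ℂ → ℂ} {s : Set ℂ} {z : ℂ} (hz : ‖z‖ = 1) :
    jacobianWithin f s z =
      (starRingEnd ℂ (fderivWithin ℝ f s z z) * fderivWithin ℝ f s z (z * Complex.I)).im := by
  have hlin : ∀ w : ℂ, fderivWithin ℝ f s z w =
      w.re * fderivWithin ℝ f s z 1 + w.im * fderivWithin ℝ f s z Complex.I := fun w => by
    have hw : w = w.re • (1 : ℂ) + w.im • Complex.I := by simp [Complex.re_add_im]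
    conv_lhs => rw [hw, map_add, map_smul, map_smul]
    simp
  have hz' : z.re * z.re + z.im * z.im = 1 := by
    rw [← Complex.normSq_apply, Complex.normSq_eq_norm_sq, hz, one_pow]
  rw [hlin z, hlin (z * Complex.I)]
  simp only [jacobianWithin, dzWithin, dzbarWithin, Complex.sq_norm, Complex.normSq_apply]
  simp
  linear_combination (-((fderivWithin ℝ f s z 1).re * (fderivWithin ℝ f s z Complex.I).im -
    (fderivWithin ℝ f s z 1).im * (fderivWithin ℝ f s z Complex.I).re)) * hz'

/-- The radial derivative of `f` within the closed disk at a point `z` of the unit circle. -/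
theorem tendsto_radial_quotient {f : ℂ → ℂ}
    (hf : DifferentiableOn ℝ f (Metric.closedBall 0 1)) {z : ℂ} (hz : ‖z‖ = 1) :
    Tendsto (fun ρ : ℝ => (f z - f (ρ * z)) / (1 - ρ)) (𝓝[<] 1)
      (𝓝 (fderivWithin ℝ f (Metric.closedBall 0 1) z z)) := by
  have hd := (hf z (by simp [hz])).hasFDerivWithinAt
  have hg : HasDerivWithinAt (fun ρ : ℝ => (ρ * z : ℂ)) z (Ioo 0 1) 1 := by
    simpa using ((hasDerivAt_id (1 : ℝ)).ofReal_comp.mul_const z).hasDerivWithinAt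
  have hcomp : HasDerivWithinAt (fun ρ : ℝ => f (ρ * z))
      (fderivWithin ℝ f (Metric.closedBall 0 1) z z) (Ioo 0 1) 1 := by
    refine HasFDerivWithinAt.comp_hasDerivWithinAt (t := Metric.closedBall 0 1) 1 ?_ hg
      fun ρ hρ => ?_
    · simpa using hd
    · simpa [hz, abs_of_pos hρ.1] using hρ.2.le
  rw [hasDerivWithinAt_iff_tendsto_slope' (by simp), nhdsWithin_Ioo_eq_nhdsLT one_pos] at hcomp
  refine hcomp.congr' (eventually_mem_nhdsWithin.mono fun ρ hρ => ?_)
  have h1 : (1 - ρ : ℝ) ≠ 0 := sub_ne_zero.2 (ne_of_gt hρ)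
  have h2 : (1 - ρ : ℂ) ≠ 0 := by exact_mod_cast h1
  have h3 : (ρ - 1 : ℂ) ≠ 0 := by rw [← neg_sub]; exact neg_ne_zero.2 h2
  rw [slope_def_module, Complex.real_smul]
  push_cast
  rw [one_mul]
  field_simp
  ring

/-- The quotient `(1 + ρ² - 2ρ Re (f(ρz) conj(f z))) / (1 - ρ²)`. When `‖f z‖ = 1` its limit as
`ρ → 1` is the real part of `conj(f z)` times the radial derivative of `f` at `z`, and on the other
hand, for harmonic `f` preserving the unit circle, it is the mean of
`‖f z - ρ f y‖² / ‖y - ρ z‖²` over `y` in the circle. -/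
noncomputable def radialQuotient (f : ℂ → ℂ) (ρ : ℝ) (z : ℂ) : ℝ :=
  (1 + ρ ^ 2 - 2 * ρ * (f (ρ * z) * starRingEnd ℂ (f z)).re) / (1 - ρ ^ 2)

/-- Splitting off the part of the difference quotient that vanishes as `ρ → 1`. -/
theorem radialQuotient_eq {f : ℂ → ℂ} {ρ : ℝ} (hρ0 : 0 ≤ ρ) (hρ : ρ < 1) {z : ℂ}
    (hz : ‖f z‖ = 1) :
    radialQuotient f ρ z = (1 - ρ) / (1 + ρ) +
      2 * ρ / (1 + ρ) * ((f z - f (ρ * z)) / (1 - ρ) * starRingEnd ℂ (f z)).re := by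
  rw [radialQuotient]
  generalize f (ρ * z) = y
  revert hz
  generalize f z = x
  intro hx
  have hx' : x.re * x.re + x.im * x.im = 1 := by
    rw [← Complex.normSq_apply, Complex.normSq_eq_norm_sq, hx, one_pow]
  have h1 : 1 - ρ ≠ 0 := by linarith
  have h2 : 1 + ρ ≠ 0 := by linarith
  have h3 : 1 - ρ ^ 2 = (1 - ρ) * (1 + ρ) := by ring
  have h4 : ((x - y) / (1 - ρ) * starRingEnd ℂ x).re =
      (1 - (y * starRingEnd ℂ x).re) / (1 - ρ) := by
    have h5 : ((x - y) / (1 - ρ) * starRingEnd ℂ x) =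
        ((x - y) * starRingEnd ℂ x) / ((1 - ρ : ℝ) : ℂ) := by
      push_cast
      ring
    rw [h5, Complex.div_ofReal_re]
    congr 1
    simp
    linear_combination hx'
  rw [h4, h3]
  field_simp
  ring

theorem continuous_radialQuotient {f : ℂ → ℂ} (hf : ContinuousOn f (Metric.closedBall 0 1)) {ρ : ℝ}
    (h0 : 0 ≤ ρ) (h1 : ρ ≤ 1) : Continuous fun θ => radialQuotient f ρ (circleMap 0 1 θ) := by
  have hc1 : Continuous fun θ => f (ρ * circleMap 0 1 θ) :=
    hf.comp_continuous (continuous_const.mul (continuous_circleMap 0 1)) fun θ => by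
      simpa [abs_of_nonneg h0] using h1
  have hc2 : Continuous fun θ => f (circleMap 0 1 θ) :=
    hf.comp_continuous (continuous_circleMap 0 1) fun θ =>
      circleMap_mem_closedBall 0 zero_le_one θ
  exact (continuous_const.sub (continuous_const.mul (Complex.continuous_re.comp
    (hc1.mul (Complex.continuous_conj.comp hc2))))).div_const _

theorem tendsto_radialQuotient {f : ℂ → ℂ} (hf : DifferentiableOn ℝ f (Metric.closedBall 0 1))
    {z : ℂ} (hz : ‖z‖ = 1) (hfz : ‖f z‖ = 1) :
    Tendsto (fun ρ => radialQuotient f ρ z) (𝓝[<] 1)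
      (𝓝 (fderivWithin ℝ f (Metric.closedBall 0 1) z z * starRingEnd ℂ (f z)).re) := by
  have h2 : Tendsto (fun ρ : ℝ => ((f z - f (ρ * z)) / (1 - ρ) * starRingEnd ℂ (f z)).re) (𝓝[<] 1)
      (𝓝 (fderivWithin ℝ f (Metric.closedBall 0 1) z z * starRingEnd ℂ (f z)).re) :=
    (Complex.continuous_re.tendsto _).comp ((tendsto_radial_quotient hf hz).mul_const _)
  have h3 : Tendsto (fun ρ : ℝ => (1 - ρ) / (1 + ρ)) (𝓝[<] 1) (𝓝 0) := by
    have : ContinuousAt (fun ρ : ℝ => (1 - ρ) / (1 + ρ)) 1 :=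
      ContinuousAt.div (by fun_prop) (by fun_prop) (by norm_num)
    simpa using this.tendsto.mono_left nhdsWithin_le_nhds
  have h4 : Tendsto (fun ρ : ℝ => 2 * ρ / (1 + ρ)) (𝓝[<] 1) (𝓝 1) := by
    have : ContinuousAt (fun ρ : ℝ => 2 * ρ / (1 + ρ)) 1 :=
      ContinuousAt.div (by fun_prop) (by fun_prop) (by norm_num)
    have h := this.tendsto.mono_left (nhdsWithin_le_nhds (s := Iio 1))
    norm_num at h
    exact h
  have h5 := h3.add (h4.mul h2)
  rw [zero_add, one_mul] at h5
  refine h5.congr' ?_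
  filter_upwards [Ioo_mem_nhdsLT (zero_lt_one' ℝ)] with ρ hρ
  exact (radialQuotient_eq hρ.1.le hρ.2 hfz).symm

/-- If `f` is Lipschitz with constant `C`, its radial quotients are uniformly bounded. -/
theorem abs_radialQuotient_le {f : ℂ → ℂ} {C : ℝ}
    (hf : DifferentiableOn ℝ f (Metric.closedBall 0 1))
    (hC : ∀ z ∈ Metric.closedBall (0 : ℂ) 1, ‖fderivWithin ℝ f (Metric.closedBall 0 1) z‖ ≤ C)
    {ρ : ℝ} (h0 : 0 ≤ ρ) (h1 : ρ < 1) {z : ℂ} (hz : ‖z‖ = 1) (hfz : ‖f z‖ = 1) :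
    |radialQuotient f ρ z| ≤ 1 + 2 * C := by
  have hlip : ‖(f z - f (ρ * z)) / (1 - ρ)‖ ≤ C := by
    have h := (convex_closedBall (0 : ℂ) 1).norm_image_sub_le_of_norm_fderivWithin_le hf hC
      (by simpa [hz, abs_of_nonneg h0] using h1.le : (ρ * z : ℂ) ∈ Metric.closedBall (0 : ℂ) 1)
      (by simp [hz] : z ∈ Metric.closedBall (0 : ℂ) 1)
    have h2 : z - ρ * z = ((1 - ρ : ℝ) : ℂ) * z := by
      push_cast
      ring
    have h3 : (1 - ρ : ℂ) = ((1 - ρ : ℝ) : ℂ) := by push_cast; rfl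
    rw [h2, norm_mul, hz, mul_one, Complex.norm_real, Real.norm_of_nonneg (by linarith)] at h
    rw [h3, norm_div, Complex.norm_real, Real.norm_of_nonneg (by linarith),
      div_le_iff₀ (by linarith)]
    exact h
  rw [radialQuotient_eq h0 h1 hfz]
  have h4 : |((f z - f (ρ * z)) / (1 - ρ) * starRingEnd ℂ (f z)).re| ≤ C := by
    refine (Complex.abs_re_le_norm _).trans ?_
    rwa [norm_mul, RCLike.norm_conj, hfz, mul_one]
  have h5 : |(1 - ρ) / (1 + ρ)| ≤ 1 := by
    rw [abs_of_nonneg (div_nonneg (by linarith) (by linarith)), div_le_one (by linarith)]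
    linarith
  have h6 : |2 * ρ / (1 + ρ)| ≤ 2 := by
    rw [abs_of_nonneg (by positivity), div_le_iff₀ (by linarith)]
    linarith
  refine (abs_add_le _ _).trans (add_le_add h5 ?_)
  rw [abs_mul]
  exact mul_le_mul h6 h4 (abs_nonneg _) zero_le_two

/-- Dominated convergence for the radial quotients of a map that is `C¹` up to the boundary. -/
theorem tendsto_integral_mul_radialQuotient {f : ℂ → ℂ}
    (hf : DifferentiableOn ℝ f (Metric.closedBall 0 1))
    (hDc : ContinuousOn (fderivWithin ℝ f (Metric.closedBall 0 1)) (Metric.closedBall 0 1))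
    (hcirc : ∀ z, ‖z‖ = 1 → ‖f z‖ = 1) {ψ : ℝ → ℝ} (hψ : Continuous ψ) :
    Tendsto (fun ρ => ∫ θ in (0 : ℝ)..2 * Real.pi, ψ θ * radialQuotient f ρ (circleMap 0 1 θ))
      (𝓝[<] 1) (𝓝 (∫ θ in (0 : ℝ)..2 * Real.pi, ψ θ *
        (fderivWithin ℝ f (Metric.closedBall 0 1) (circleMap 0 1 θ) (circleMap 0 1 θ) *
          starRingEnd ℂ (f (circleMap 0 1 θ))).re)) := by
  obtain ⟨C, hC⟩ := (isCompact_closedBall (0 : ℂ) 1).exists_bound_of_continuousOn hDc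
  have hn : ∀ θ, ‖circleMap 0 1 θ‖ = 1 := fun θ => by simp
  have hIoo := Ioo_mem_nhdsLT (zero_lt_one' ℝ)
  refine intervalIntegral.tendsto_integral_filter_of_dominated_convergence
    (fun θ => |ψ θ| * (1 + 2 * C)) ?_ ?_ ?_ ?_
  · filter_upwards [hIoo] with ρ hρ
    exact (hψ.mul (continuous_radialQuotient hf.continuousOn hρ.1.le hρ.2.le)).aestronglyMeasurable
  · filter_upwards [hIoo] with ρ hρ
    refine Eventually.of_forall fun θ _ => ?_
    rw [Real.norm_eq_abs, abs_mul]
    exact mul_le_mul_of_nonneg_left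
      (abs_radialQuotient_le hf hC hρ.1.le hρ.2 (hn θ) (hcirc _ (hn θ))) (abs_nonneg _)
  · exact (hψ.abs.mul continuous_const).intervalIntegrable _ _
  · exact Eventually.of_forall fun θ _ =>
      (tendsto_radialQuotient hf (hn θ) (hcirc _ (hn θ))).const_mul _

/-! ### The boundary integral of the Jacobian -/

/-- The lower bound before the passage to the limit. The logarithmic potential in the lower bound
for the radial quotient at `e ^ (i θ)` depends only on the boundary value `e ^ (i φ(θ))`, and its
integral over the unit circle vanishes. -/
theorem two_pi_le_integral_abs_deriv_mul_radialQuotient {f : ℂ → ℂ}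
    (hf : HarmonicContOnCl f (Metric.ball 0 1))
    (hmaps : MapsTo f (Metric.ball 0 1) (Metric.ball 0 1))
    (hcirc : ∀ z, ‖z‖ = 1 → ‖f z‖ = 1)
    (hsurj : ∀ w : ℂ, ‖w‖ = 1 → ∃ t ∈ Icc 0 (2 * Real.pi), f (circleMap 0 1 t) = w)
    {φ φ' : ℝ → ℝ} (hφ'c : Continuous φ') (hφd : ∀ t, HasDerivAt φ (φ' t) t)
    (hφ : ∀ t, f (circleMap 0 1 t) = circleMap 0 1 (φ t)) {ρ : ℝ} (h0 : 0 ≤ ρ) (h1 : ρ < 1) :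
    2 * Real.pi ≤
      ∫ θ in (0 : ℝ)..2 * Real.pi, |φ' θ| * radialQuotient f ρ (circleMap 0 1 θ) := by
  have hpi := Real.pi_pos
  have hn : ∀ θ, ‖circleMap 0 1 θ‖ = 1 := fun θ => by simp
  have hFn : ∀ θ, ‖f (circleMap 0 1 θ)‖ = 1 := fun θ => hcirc _ (hn θ)
  have hFc : Continuous fun θ => f (circleMap 0 1 θ) :=
    hf.continuousOn_ball.comp_continuous (continuous_circleMap 0 1) fun θ =>
      circleMap_mem_closedBall 0 zero_le_one θ
  set A : ℝ → ℝ := fun u =>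
    Real.circleAverage (fun y => 2 * Real.log ‖circleMap 0 1 u - ρ * f y‖) 0 1 with hA
  have hAc : Continuous A := by
    have hI : Continuous fun u => ∫ t in (0 : ℝ)..2 * Real.pi,
        2 * Real.log ‖circleMap 0 1 u - ρ * f (circleMap 0 1 t)‖ := by
      refine intervalIntegral.continuous_parametric_intervalIntegral_of_continuous' ?_ _ _
      refine continuous_const.mul (Continuous.log ?_ fun p => ?_)
      · have : Continuous fun p : ℝ × ℝ => f (circleMap 0 1 p.2) := hFc.comp continuous_snd
        exact (((continuous_circleMap 0 1).comp continuous_fst).sub (continuous_const.mul this)).norm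
      · exact (norm_sub_mul_pos h0 h1 (hn _) (hFn _)).ne'
    simp only [hA, Real.circleAverage_def, smul_eq_mul]
    exact continuous_const.mul hI
  have hAint : ∫ u in (0 : ℝ)..2 * Real.pi, A u = 0 := by
    have h := integral_integral_log_norm_sub_mul_eq_zero hFc hFn h0 h1
    simp only [hA, Real.circleAverage_def]
    rw [intervalIntegral.integral_smul, h, smul_zero]
  have hGc : Continuous fun u => max 0 (1 + A u) := by fun_prop
  calc 2 * Real.pi = ∫ u in (0 : ℝ)..2 * Real.pi, (1 + A u) := by
        rw [intervalIntegral.integral_add (by simp) (hAc.intervalIntegrable _ _), hAint]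
        simp
    _ ≤ ∫ u in (0 : ℝ)..2 * Real.pi, max 0 (1 + A u) :=
        intervalIntegral.integral_mono_on (by positivity)
          ((continuous_const.add hAc).intervalIntegrable _ _) (hGc.intervalIntegrable _ _)
          fun u _ => le_max_right _ _
    _ ≤ ∫ t in (0 : ℝ)..2 * Real.pi, |φ' t| * max 0 (1 + A (φ t)) := by
        refine integral_period_le_integral_abs_deriv_mul hφ'c hφd
          (G := fun u => max 0 (1 + A u)) (fun u => ?_) hGc (fun u => le_max_left _ _)
          (fun u => by simp only [hA, periodic_circleMap 0 1 u])
        obtain ⟨t, ht, htu⟩ := hsurj _ (hn u)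
        exact ⟨t, ht, by rw [← hφ t]; exact htu⟩
    _ ≤ ∫ t in (0 : ℝ)..2 * Real.pi, |φ' t| * radialQuotient f ρ (circleMap 0 1 t) := by
        have hφc : Continuous φ := continuous_iff_continuousAt.2 fun t => (hφd t).continuousAt
        have hQ := continuous_radialQuotient hf.continuousOn_ball h0 h1.le
        refine intervalIntegral.integral_mono_on (by positivity)
          (Continuous.intervalIntegrable (by fun_prop) _ _)
          (Continuous.intervalIntegrable (by fun_prop) _ _) fun t _ => ?_
        refine mul_le_mul_of_nonneg_left (max_le ?_ ?_) (abs_nonneg _)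
        · refine div_nonneg ?_ (by nlinarith)
          have h2 : |(f (ρ * circleMap 0 1 t) * starRingEnd ℂ (f (circleMap 0 1 t))).re| ≤ 1 := by
            refine (Complex.abs_re_le_norm _).trans ?_
            have h3 : (ρ * circleMap 0 1 t : ℂ) ∈ Metric.ball (0 : ℂ) 1 := by
              simpa [abs_of_nonneg h0] using h1
            have h4 := mem_ball_zero_iff.1 (hmaps h3)
            rw [norm_mul, RCLike.norm_conj, hFn, mul_one]
            exact h4.le
          nlinarith [(abs_le.1 h2).2, sq_nonneg (1 - ρ)]
        · have h := one_add_circleAverage_log_le hf hcirc h0 h1 (hFn t) (hn t)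
          simp only [hA, ← hφ t]
          exact h

theorem corollary2 (f : ℂ → ℂ)
    (hbij : Set.BijOn f (Metric.ball 0 1) (Metric.ball 0 1))
    (hharm : InnerProductSpace.HarmonicOnNhd f (Metric.ball 0 1))
    (hC1 : ContDiffOn ℝ 1 f (Metric.closedBall 0 1)) :
    2 * Real.pi ≤
      ∫ θ in (0 : ℝ)..2 * Real.pi,
        |jacobianWithin f (Metric.closedBall 0 1) (circleMap 0 1 θ)| := by
  have huniq : UniqueDiffOn ℝ (Metric.closedBall (0 : ℂ) 1) :=
    uniqueDiffOn_convex (convex_closedBall _ _)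
      ⟨0, by rw [interior_closedBall _ one_ne_zero]; simp⟩
  have hDc := hC1.continuousOn_fderivWithin huniq le_rfl
  have hdiff : DifferentiableOn ℝ f (Metric.closedBall 0 1) := hC1.differentiableOn one_ne_zero
  have hf : HarmonicContOnCl f (Metric.ball 0 1) := .mk_ball hharm hC1.continuousOn
  have hcirc : ∀ z, ‖z‖ = 1 → ‖f z‖ = 1 := fun z hz => norm_eq_one_of_bijOn hbij hf hz
  have hmem : ∀ θ, circleMap 0 1 θ ∈ Metric.closedBall (0 : ℂ) 1 := fun θ =>
    circleMap_mem_closedBall 0 zero_le_one θ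
  have hn : ∀ θ, ‖circleMap 0 1 θ‖ = 1 := fun θ => by simp
  set D := fderivWithin ℝ f (Metric.closedBall 0 1) with hD
  have hDcirc : Continuous fun θ => D (circleMap 0 1 θ) :=
    hDc.comp_continuous (continuous_circleMap 0 1) hmem
  have hFd : ∀ θ, HasDerivAt (fun θ => f (circleMap 0 1 θ))
      (D (circleMap 0 1 θ) (circleMap 0 1 θ * Complex.I)) θ := fun θ => by
    have h := (hdiff _ (hmem θ)).hasFDerivWithinAt.comp_hasDerivWithinAt (s := univ) θ
      (hasDerivAt_circleMap 0 1 θ).hasDerivWithinAt fun t _ => hmem t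
    exact hasDerivWithinAt_univ.1 h
  have hFc : Continuous fun θ => f (circleMap 0 1 θ) :=
    continuous_iff_continuousAt.2 fun t => (hFd t).continuousAt
  obtain ⟨φ, φ', hφ'c, hφd, hFφ, hF'⟩ := exists_phase_of_norm_eq_one hFd
    (hDcirc.clm_apply ((continuous_circleMap 0 1).mul continuous_const)) fun θ => hcirc _ (hn θ)
  -- the Jacobian is the tangential speed `φ'` times `N = Re (f_r conj f)`
  set N : ℝ → ℝ := fun θ =>
    (D (circleMap 0 1 θ) (circleMap 0 1 θ) * starRingEnd ℂ (f (circleMap 0 1 θ))).re with hN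
  have hJ : ∀ θ, jacobianWithin f (Metric.closedBall 0 1) (circleMap 0 1 θ) = φ' θ * N θ :=
    fun θ => by
      rw [jacobianWithin_eq_im (hn θ), ← hD, hF' θ, hN]
      simp
      ring
  have hNc : Continuous N := Complex.continuous_re.comp
    ((hDcirc.clm_apply (continuous_circleMap 0 1)).mul (Complex.continuous_conj.comp hFc))
  calc 2 * Real.pi ≤ ∫ θ in (0 : ℝ)..2 * Real.pi, |φ' θ| * N θ := by
        refine ge_of_tendsto (tendsto_integral_mul_radialQuotient hdiff hDc hcirc hφ'c.abs) ?_
        filter_upwards [Ioo_mem_nhdsLT (zero_lt_one' ℝ)] with ρ hρ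
        exact two_pi_le_integral_abs_deriv_mul_radialQuotient hf hbij.mapsTo hcirc
          (fun w hw => exists_circleMap_eq_of_bijOn hbij hC1.continuousOn hw) hφ'c hφd hFφ
          hρ.1.le hρ.2
    _ ≤ _ := by
        simp only [hJ, abs_mul]
        exact intervalIntegral.integral_mono_on Real.two_pi_pos.le
          ((hφ'c.abs.mul hNc).intervalIntegrable _ _)
          ((hφ'c.abs.mul hNc.abs).intervalIntegrable _ _)
          fun θ _ => mul_le_mul_of_nonneg_left (le_abs_self _) (abs_nonneg _)
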